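/- For $1\le k\le 4$ let $\vec v_k=e^{ik\pi/4}\in\mathbb C=\mathbb R^2$, and let $\vec e_1,\dots,\vec e_4$ be the canonical basis of $\mathbb R^4$. An octagonal tiling is a covering of the plane by translates of the six rhombi $\{\lambda\vec v_i+\mu\vec v_j : 0\le\lambda,\mu\le 1\}$, $1\le i<j\le 4$, in which any two distinct tiles are disjoint or intersect exactly in a common vertex or along a common complete edge. (Two of the six are unit squares; the other four are unit rhombi with angles $45^\circ$ and $135^\circ$.) The two notched tiles are the following tiles with an arrow (notch) on each edge: the rhombus with angles $45^\circ$ and $135^\circ$, in which the four arrows point away from the acute vertices; and the square, in which the arrows of any two opposite edges point in the same direction. A tiling by the two notched tiles is an octagonal tiling each of whose edges can be given an arrow, common to the two tiles at that edge, so that every tile becomes a copy of one of the two notched tiles. (Equivalently, any two rhombi that are adjacent along an edge, or connected by a row of lined-up squares, have different orientations.) A lift of an octagonal tiling maps each tile with edges $\vec v_i,\vec v_j$ to a unit face $z+[0,1]\vec e_i+[0,1]\vec e_j$ with $z\in\mathbb Z^4$, in such a way that two tiles sharing an edge of direction $\vec v_k$ are mapped to faces sharing the corresponding edge of direction $\vec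 e_k$. Lemma. There is a constant $t\ge 1$ such that for every tiling $\mathcal T$ of the plane by the two notched tiles there is a two-dimensional affine plane $E\subset\mathbb R^4$ such that $\mathcal T$ has a lift all of whose faces lie in $E+[0,t]^4$. That is, all tilings by the two notched tiles are planar, with uniformly bounded thickness. -/

import Mathlib

open scoped Pointwise

noncomputable section

namespace Octagonal

/-- The four edge directions `exp (i k π / 4)`, `k = 1, 2, 3, 4`; the direction of index `k` is
stored at the index `k - 1 : Fin 4`. -/
def v (k : Fin 4) : ℂ := Complex.exp ((((k : ℕ) + 1 : ℝ) * (Real.pi / 4) : ℝ) * Complex.I)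

/-- The canonical basis of `ℤ⁴`. -/
def e (k : Fin 4) : Fin 4 → ℤ := Pi.single k 1

/-- The vector `∑ d_k v_k` of the plane. -/
def proj (d : Fin 4 → ℤ) : ℂ := ∑ k, (d k : ℂ) * v k

/-- A translate of one of the six rhombi spanned by `v i` and `v j`, `i < j`. -/
structure Tile where
  base : ℂ
  i : Fin 4
  j : Fin 4
  lt : i < j

namespace Tile

/-- The closed rhombus of the plane. -/
def carrier (t : Tile) : Set ℂ :=
  {x | ∃ a ∈ Set.Icc (0 : ℝ) 1, ∃ b ∈ Set.Icc (0 : ℝ) 1, x = t.base + a * v t.i + b * v t.j}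

/-- The four vertices. -/
def vertices (t : Tile) : Set ℂ :=
  {t.base, t.base + v t.i, t.base + v t.j, t.base + v t.i + v t.j}

/-- The four edges, each given by the integer displacement of its starting point from the base
point of the tile, and by the index of its direction. -/
def edges (t : Tile) : Set ((Fin 4 → ℤ) × Fin 4) :=
  {(0, t.i), (e t.j, t.i), (0, t.j), (e t.i, t.j)}

/-- The starting point, in the plane, of the edge with displacement `d`. -/
def edgeStart (t : Tile) (d : Fin 4 → ℤ) : ℂ := t.base + proj d

/-- The complete edges, as segments of the plane. -/
def edgeSegments (t : Tile) : Set (Set ℂ) :=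
  {S | ∃ q ∈ t.edges, S = segment ℝ (t.edgeStart q.1) (t.edgeStart q.1 + v q.2)}

/-- The two-dimensional unit face of `ℝ⁴` at the integer point `z`, with the edge directions
of `t`. -/
def face (t : Tile) (z : Fin 4 → ℤ) : Set (Fin 4 → ℝ) :=
  {x | ∃ a ∈ Set.Icc (0 : ℝ) 1, ∃ b ∈ Set.Icc (0 : ℝ) 1,
    x = (fun k => (z k : ℝ)) + a • (Pi.single t.i 1 : Fin 4 → ℝ)
      + b • (Pi.single t.j 1 : Fin 4 → ℝ)}

/-- A notching of edges puts an arrow on every edge: for the edge from `p` to `p + v k`,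
`σ p k = true` if the arrow points from `p` to `p + v k`, and `σ p k = false` if it points from
`p + v k` to `p`. The tile `t` with the arrows `σ` on its edges is a copy of one of the two notched
tiles:
* the rhombus with angles `45°` and `135°`, where all four arrows point away from the two
  acute vertices (these are `p`, `p + v i + v j` if `v i` and `v j` form an acute angle, and
  `p + v i`, `p + v j` if they form an obtuse one, `p` being the base point);
* the square, where the arrows of opposite edges are translates of each other. -/
def IsNotched (t : Tile) (σ : ℂ → Fin 4 → Bool) : Prop :=
  (0 < inner ℝ (v t.i) (v t.j) →
    σ t.base t.i = true ∧ σ (t.base + v t.j) t.i = false ∧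
    σ t.base t.j = true ∧ σ (t.base + v t.i) t.j = false) ∧
  (inner ℝ (v t.i) (v t.j) < 0 →
    σ t.base t.i = false ∧ σ (t.base + v t.j) t.i = true ∧
    σ t.base t.j = false ∧ σ (t.base + v t.i) t.j = true) ∧
  (inner ℝ (v t.i) (v t.j) = 0 →
    σ (t.base + v t.j) t.i = σ t.base t.i ∧ σ (t.base + v t.i) t.j = σ t.base t.j)

end Tile

/-- An octagonal tiling: the tiles cover the plane, and any two distinct tiles are disjoint or
intersect in a common vertex or along a common complete edge. -/
def IsTiling (T : Set Tile) : Prop :=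
  (⋃ t ∈ T, t.carrier) = Set.univ ∧
  ∀ s ∈ T, ∀ t ∈ T, s ≠ t →
    s.carrier ∩ t.carrier = ∅ ∨
    (∃ p ∈ s.vertices ∩ t.vertices, s.carrier ∩ t.carrier = {p}) ∨
    s.carrier ∩ t.carrier ∈ s.edgeSegments ∩ t.edgeSegments

/-- A tiling of the plane by the two notched tiles: an octagonal tiling whose edges can be given
arrows, the same for both tiles at an edge, that make every tile a notched tile. -/
def IsNotchedTiling (T : Set Tile) : Prop :=
  IsTiling T ∧ ∃ σ : ℂ → Fin 4 → Bool, ∀ t ∈ T, t.IsNotched σ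

/-- `L` gives the base points of the faces of a lift of `T`: any two tiles that share an edge
`[p, p + v k]` are sent to faces that share the corresponding edge of direction `e k`. -/
def IsLift (T : Set Tile) (L : Tile → Fin 4 → ℤ) : Prop :=
  ∀ s ∈ T, ∀ t ∈ T, ∀ k d d', (d, k) ∈ s.edges → (d', k) ∈ t.edges →
    s.edgeStart d = t.edgeStart d' → L s + d = L t + d'

/-- The surface of `ℝ⁴` formed by the faces of a lift. -/
def liftSurface (T : Set Tile) (L : Tile → Fin 4 → ℤ) : Set (Fin 4 → ℝ) :=
  ⋃ t ∈ T, t.face (L t)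

/-- The slice `E + [0, τ]⁴`. -/
def slice (E : AffineSubspace ℝ (Fin 4 → ℝ)) (τ : ℝ) : Set (Fin 4 → ℝ) :=
  (E : Set (Fin 4 → ℝ)) + Set.Icc (0 : Fin 4 → ℝ) (fun _ => τ)

/-- `T` is planar, with thickness at most `τ`: it can be lifted into a slice `E + [0, τ]⁴` of a
two-dimensional plane `E`. -/
def IsPlanar (T : Set Tile) (τ : ℝ) : Prop :=
  ∃ E : AffineSubspace ℝ (Fin 4 → ℝ), Module.finrank ℝ E.direction = 2 ∧
    ∃ L : Tile → Fin 4 → ℤ, IsLift T L ∧ liftSurface T L ⊆ slice E τ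

end Octagonal

end

/-! The faces of a lift fit together into a map `h` from the plane to `ℝ⁴` that is linear on each
tile. It exists because the plane is simply connected, and it satisfies `∑ k, (h x k - h 0 k) v k =
x` (`IsHeight.sum_eq`).

The arrows act on `h` through Ammann bars. For generic `θ`, the tiles met along a connected part of
`{h k = θ}` form a row, glued along edges of direction `v k`. From one such edge of a notched tile
to the opposite one, `⟪p, v k⟫` changes by `±√2/2` in a rhombus and by `0` in a square, and the
arrow flips in the rhombus only, so that `level` stays constant. Each row therefore stays within
bounded distance of a straight line perpendicular to `v k`. Since `h k` has slope between `0` and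
`1` along `v k`, it depends only on `⟪x, v k⟫` up to an error of `6` (`IsHeight.sub_le_six`).

Thus `h k` is, up to a bounded error, a function `ψ k` of `⟪x, v k⟫`. Reconstructing `x` from its
four heights forces each `ψ k` to be additive up to a constant (`almost_additive`), hence linear up
to a constant by Hyers' theorem. So `h` stays close to an injective linear map, whose range directs
the plane `E`, with constants that do not depend on the tiling. -/

open Topology Filter

/-! ### Potentials on a simply connected space, by a covering space argument. -/

/-- The space of germs of potentials of the difference cochain `G`: a point of the base together
with the value of the potential there. -/
structure PotentialSpace {X V : Type*} (G : X → X → V) where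
  /-- the point of the base -/
  pt : X
  /-- the value of the potential -/
  val : V

namespace PotentialSpace

variable {X V : Type*} [TopologicalSpace X] [AddCommGroup V] (G : X → X → V)

/-- The topology of an étalé space: open sets contain, with each point, the nearby part of the local
potential through it. -/
instance : TopologicalSpace (PotentialSpace G) where
  IsOpen W := ∀ p ∈ W, ∀ᶠ y in 𝓝 p.pt, (⟨y, p.val + G p.pt y⟩ : PotentialSpace G) ∈ W
  isOpen_univ _ _ := Eventually.of_forall fun _ => trivial
  isOpen_inter _ _ h₁ h₂ p hp := (h₁ p hp.1).and (h₂ p hp.2)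
  isOpen_sUnion _ h p := fun ⟨W, hW, hp⟩ =>
    (h W hW p hp).mono fun _ hy => ⟨W, hW, hy⟩

theorem isOpen_iff (W : Set (PotentialSpace G)) :
    IsOpen W ↔ ∀ p ∈ W, ∀ᶠ y in 𝓝 p.pt, (⟨y, p.val + G p.pt y⟩ : PotentialSpace G) ∈ W :=
  Iff.rfl

variable {G}

theorem isOpen_pt_preimage {U : Set X} (hU : IsOpen U) :
    IsOpen ((pt : PotentialSpace G → X) ⁻¹' U) :=
  (isOpen_iff G _).2 fun _ hp => IsOpen.mem_nhds hU hp

/-- Over `U` the map `(y, c) ↦ (y, c - G x y)` is a trivialization with discrete fibre `V`: the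
cocycle condition on `U` says that the sheets are the graphs of the functions `G x + const`. -/
theorem isCoveringMap_pt
    (hG : ∀ x, ∃ U, IsOpen U ∧ x ∈ U ∧ ∀ y ∈ U, ∀ᶠ z in 𝓝 y, G y z = G x z - G x y) :
    IsCoveringMap (pt : PotentialSpace G → X) := by
  intro x
  obtain ⟨U, hU, hxU, h⟩ := hG x
  let _ : TopologicalSpace V := ⊥
  have hV : DiscreteTopology V := ⟨rfl⟩
  refine IsEvenlyCovered.to_isEvenlyCovered_preimage (I := V)
    ⟨hV, U, hxU, hU, isOpen_pt_preimage hU, ?_⟩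
  have key : ∀ y ∈ U, ∀ᶠ z in 𝓝 y, z ∈ U ∧ G y z = G x z - G x y := fun y hy =>
    Filter.Eventually.and (IsOpen.mem_nhds hU hy) (h y hy)
  refine ⟨{ toFun := fun p => (⟨p.1.pt, p.2⟩, p.1.val - G x p.1.pt)
            invFun := fun q => ⟨⟨q.1.1, q.2 + G x q.1.1⟩, q.1.2⟩
            left_inv := fun p => Subtype.ext (by simp)
            right_inv := fun q => Prod.ext rfl (add_sub_cancel_right _ _)
            continuous_toFun := ?_
            continuous_invFun := ?_ }, fun _ => rfl⟩
  · refine continuous_def.2 fun O hO => ?_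
    let W : Set (PotentialSpace G) :=
      {p | ∃ hp : p.pt ∈ U, ((⟨p.pt, hp⟩ : U), p.val - G x p.pt) ∈ O}
    have hW : IsOpen W := by
      rw [isOpen_iff]
      rintro ⟨y, c⟩ ⟨hy, hyO⟩
      have h1 : ∀ᶠ z : U in 𝓝 ⟨y, hy⟩, (z, c - G x y) ∈ O :=
        (Continuous.prodMk_left (c - G x y)).continuousAt.eventually (hO.mem_nhds hyO)
      rw [nhds_subtype_eq_comap, eventually_comap] at h1
      filter_upwards [h1, key y hy] with z hz1 hz2
      refine ⟨hz2.1, ?_⟩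
      have h3 : c + G y z - G x z = c - G x y := by rw [hz2.2]; abel
      simpa only [h3] using hz1 ⟨z, hz2.1⟩ rfl
    convert hW.preimage continuous_subtype_val using 1
    ext p
    exact ⟨fun hp => ⟨p.2, hp⟩, fun ⟨_, hp⟩ => hp⟩
  · refine continuous_induced_rng.2 (continuous_def.2 fun W hW => ?_)
    refine isOpen_iff_mem_nhds.2 ?_
    rintro ⟨⟨y, hy⟩, c⟩ hyc
    rw [nhds_prod_eq, nhds_discrete V, prod_pure, Filter.mem_map, ← Filter.eventually_mem_set,
      nhds_subtype_eq_comap, eventually_comap]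
    have h1 := (isOpen_iff G W).1 hW ⟨y, c + G x y⟩ hyc
    filter_upwards [h1, key y hy] with z hz1 hz2
    rintro ⟨b, hb⟩ rfl
    have h3 : c + G x y + G y b = c + G x b := by rw [hz2.2]; abel
    rw [h3] at hz1
    exact hz1

end PotentialSpace

/-- On a simply connected space, a function of two variables that is locally the difference of a
potential is so globally. -/
theorem exists_potential {X V : Type*} [TopologicalSpace X] [SimplyConnectedSpace X]
    [LocallyPathConnectedSpace X] [AddCommGroup V] (G : X → X → V)
    (hG : ∀ x, ∃ U, IsOpen U ∧ x ∈ U ∧ ∀ y ∈ U, ∀ᶠ z in 𝓝 y, G y z = G x z - G x y) :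
    ∃ h : X → V, ∀ x, ∀ᶠ z in 𝓝 x, h z = h x + G x z := by
  obtain ⟨x₀⟩ : Nonempty X := inferInstance
  obtain ⟨F, ⟨-, hF⟩, -⟩ := (PotentialSpace.isCoveringMap_pt hG).existsUnique_continuousMap_lifts
    (ContinuousMap.id X) x₀ ⟨x₀, 0⟩ rfl
  have hF1 : ∀ x, (F x).pt = x := fun x => congrFun hF x
  refine ⟨fun x => (F x).val, fun x => ?_⟩
  obtain ⟨U, hU, hxU, h⟩ := hG x
  have hxx : G x x = 0 := by simpa using (h x hxU).self_of_nhds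
  -- `W` is the sheet through `F x`. It is open, so the continuous section `F` stays in it near `x`.
  let W : Set (PotentialSpace G) := {p | p.pt ∈ U ∧ p.val = (F x).val + G x p.pt}
  have hW : IsOpen W := by
    rw [PotentialSpace.isOpen_iff]
    rintro ⟨y, c⟩ ⟨hy, hc⟩
    filter_upwards [h y hy, IsOpen.mem_nhds hU hy] with z hz hzU
    refine ⟨hzU, ?_⟩
    simp only at hc ⊢
    rw [hz, hc]
    abel
  have hxW : F x ∈ W := ⟨by rw [hF1]; exact hxU, by rw [hF1, hxx, add_zero]⟩
  filter_upwards [F.continuous.continuousAt.eventually (hW.mem_nhds hxW)] with z hz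
  have := hz.2
  rwa [hF1] at this

/-! ### Edge directions and linear coordinates on a single tile. -/

namespace Octagonal

/-- The cross product of two vectors of the plane. -/
def cr (z w : ℂ) : ℝ := z.re * w.im - z.im * w.re

theorem cr_add_left (z z' w : ℂ) : cr (z + z') w = cr z w + cr z' w := by simp [cr]; ring
theorem cr_add_right (z w w' : ℂ) : cr z (w + w') = cr z w + cr z w' := by simp [cr]; ring
theorem cr_smul_left (a : ℝ) (z w : ℂ) : cr (a * z) w = a * cr z w := by simp [cr]; ring
theorem cr_smul_right (a : ℝ) (z w : ℂ) : cr z (a * w) = a * cr z w := by simp [cr]; ring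
theorem cr_self (z : ℂ) : cr z z = 0 := by simp [cr]; ring
theorem cr_swap (z w : ℂ) : cr w z = -cr z w := by simp [cr]; ring

theorem abs_cr_le (z w : ℂ) : |cr z w| ≤ ‖z‖ * ‖w‖ := by
  rw [← abs_of_nonneg (by positivity : 0 ≤ ‖z‖ * ‖w‖), ← sq_le_sq, mul_pow, Complex.sq_norm,
    Complex.sq_norm, Complex.normSq_apply, Complex.normSq_apply, cr]
  nlinarith [sq_nonneg (z.re * w.re + z.im * w.im)]

theorem v_zero : v 0 = ⟨√2 / 2, √2 / 2⟩ := by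
  have h : v 0 = Complex.exp ((Real.pi / 4 : ℝ) * Complex.I) := by simp [v]
  rw [h]
  apply Complex.ext
  · rw [Complex.exp_ofReal_mul_I_re, Real.cos_pi_div_four]
  · rw [Complex.exp_ofReal_mul_I_im, Real.sin_pi_div_four]

theorem v_one : v 1 = ⟨0, 1⟩ := by
  have h : v 1 = Complex.exp ((Real.pi / 2 : ℝ) * Complex.I) := by
    rw [v]; congr 3; norm_num; ring
  rw [h]
  apply Complex.ext
  · rw [Complex.exp_ofReal_mul_I_re, Real.cos_pi_div_two]
  · rw [Complex.exp_ofReal_mul_I_im, Real.sin_pi_div_two]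

theorem v_two : v 2 = ⟨-(√2 / 2), √2 / 2⟩ := by
  have h : v 2 = Complex.exp ((Real.pi - Real.pi / 4 : ℝ) * Complex.I) := by
    rw [v]; congr 3; norm_num; ring
  rw [h]
  apply Complex.ext
  · rw [Complex.exp_ofReal_mul_I_re, Real.cos_pi_sub, Real.cos_pi_div_four]
  · rw [Complex.exp_ofReal_mul_I_im, Real.sin_pi_sub, Real.sin_pi_div_four]

theorem v_three : v 3 = ⟨-1, 0⟩ := by
  have h : v 3 = Complex.exp ((Real.pi : ℝ) * Complex.I) := by
    rw [v]; congr 3; norm_num; ring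
  rw [h]
  apply Complex.ext
  · rw [Complex.exp_ofReal_mul_I_re, Real.cos_pi]
  · rw [Complex.exp_ofReal_mul_I_im, Real.sin_pi]

theorem norm_v (k : Fin 4) : ‖v k‖ = 1 := by
  rw [v, Complex.norm_exp_ofReal_mul_I]

theorem half_le_cr {i j : Fin 4} (h : i < j) : 1 / 2 ≤ cr (v i) (v j) := by
  have h2 : (1 : ℝ) ≤ √2 := Real.one_le_sqrt.2 (by norm_num)
  have h3 : √2 * √2 = 2 := Real.mul_self_sqrt (by norm_num)
  fin_cases i <;> fin_cases j <;>
    first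
    | exact absurd h (by decide)
    | (simp only [cr, Fin.zero_eta, Fin.mk_one, Fin.reduceFinMk, v_zero, v_one, v_two, v_three]
       nlinarith)

theorem cr_pos {i j : Fin 4} (h : i < j) : 0 < cr (v i) (v j) :=
  lt_of_lt_of_le (by norm_num) (half_le_cr h)

theorem cr_ne_zero {i j : Fin 4} (h : i ≠ j) : cr (v i) (v j) ≠ 0 := by
  rcases lt_or_gt_of_ne h with h | h
  · exact (cr_pos h).ne'
  · rw [cr_swap]; exact neg_ne_zero.2 (cr_pos h).ne'

theorem v_ne_zero (k : Fin 4) : v k ≠ 0 := by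
  rw [← norm_ne_zero_iff, norm_v]; exact one_ne_zero

namespace Tile

variable (t : Tile)

theorem ne : t.i ≠ t.j := t.lt.ne

/-- The linear lift of the plane that sends the two edge directions of `t` to the corresponding
vectors of the canonical basis. -/
noncomputable def lin : ℂ →ₗ[ℝ] (Fin 4 → ℝ) where
  toFun u := Pi.single t.i (cr u (v t.j) / cr (v t.i) (v t.j))
    + Pi.single t.j (cr (v t.i) u / cr (v t.i) (v t.j))
  map_add' x y := by
    rw [cr_add_left, cr_add_right, add_div, add_div, Pi.single_add, Pi.single_add]; abel
  map_smul' a x := by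
    rw [Complex.real_smul, cr_smul_left, cr_smul_right, mul_div_assoc, mul_div_assoc, smul_add,
      ← Pi.single_smul, ← Pi.single_smul]; rfl

theorem lin_i (u : ℂ) : t.lin u t.i = cr u (v t.j) / cr (v t.i) (v t.j) := by
  simp [lin, t.ne]

theorem lin_j (u : ℂ) : t.lin u t.j = cr (v t.i) u / cr (v t.i) (v t.j) := by
  simp [lin, t.ne.symm]

theorem lin_of_ne {k : Fin 4} (hi : k ≠ t.i) (hj : k ≠ t.j) (u : ℂ) : t.lin u k = 0 := by
  simp [lin, hi, hj]

theorem lin_v_i : t.lin (v t.i) = Pi.single t.i 1 := by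
  simp [lin, cr_self, div_self (cr_ne_zero t.ne)]

theorem lin_v_j : t.lin (v t.j) = Pi.single t.j 1 := by
  simp [lin, cr_self, div_self (cr_ne_zero t.ne)]

theorem lin_mul (a : ℝ) (u : ℂ) : t.lin (a * u) = a • t.lin u := by
  rw [← Complex.real_smul, map_smul]

theorem lin_comb (a b : ℝ) : t.lin (a * v t.i + b * v t.j) =
    a • (Pi.single t.i 1 : Fin 4 → ℝ) + b • (Pi.single t.j 1 : Fin 4 → ℝ) := by
  rw [map_add, lin_mul, lin_mul, lin_v_i, lin_v_j]

theorem comb_lin (u : ℂ) : (t.lin u t.i : ℂ) * v t.i + (t.lin u t.j : ℂ) * v t.j = u := by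
  have h := cr_ne_zero t.ne
  rw [lin_i, lin_j]
  apply Complex.ext
  · simp only [Complex.add_re, Complex.re_ofReal_mul]
    field_simp
    simp only [cr]; ring
  · simp only [Complex.add_im, Complex.im_ofReal_mul]
    field_simp
    simp only [cr]; ring

theorem sum_lin (u : ℂ) : ∑ k, (t.lin u k : ℂ) * v k = u := by
  rw [← Finset.sum_subset (Finset.subset_univ {t.i, t.j}), Finset.sum_pair t.ne, comb_lin]
  intro k _ hk
  simp only [Finset.mem_insert, Finset.mem_singleton, not_or] at hk
  rw [lin_of_ne t hk.1 hk.2]; simp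

theorem abs_lin_le (u : ℂ) (k : Fin 4) : |t.lin u k| ≤ 2 * ‖u‖ := by
  have h := half_le_cr t.lt
  have hp := cr_pos t.lt
  by_cases hi : k = t.i
  · rw [hi, lin_i, abs_div, abs_of_pos hp, div_le_iff₀ hp]
    have := abs_cr_le u (v t.j)
    rw [norm_v] at this
    nlinarith [norm_nonneg u]
  by_cases hj : k = t.j
  · rw [hj, lin_j, abs_div, abs_of_pos hp, div_le_iff₀ hp]
    have := abs_cr_le (v t.i) u
    rw [norm_v] at this
    nlinarith [norm_nonneg u]
  · rw [lin_of_ne t hi hj, abs_zero]; positivity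

theorem mem_carrier_iff {x : ℂ} : x ∈ t.carrier ↔
    t.lin (x - t.base) t.i ∈ Set.Icc (0 : ℝ) 1 ∧ t.lin (x - t.base) t.j ∈ Set.Icc (0 : ℝ) 1 := by
  constructor
  · rintro ⟨a, ha, b, hb, rfl⟩
    rw [show t.base + a * v t.i + b * v t.j - t.base = a * v t.i + b * v t.j by ring, lin_comb]
    simpa [t.ne, t.ne.symm] using ⟨ha, hb⟩
  · rintro ⟨ha, hb⟩
    refine ⟨_, ha, _, hb, ?_⟩
    rw [add_assoc, comb_lin]; ring

theorem isClosed_carrier : IsClosed t.carrier := by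
  have h : t.carrier = (fun x => t.lin (x - t.base) t.i) ⁻¹' Set.Icc 0 1 ∩
      (fun x => t.lin (x - t.base) t.j) ⁻¹' Set.Icc 0 1 := by
    ext x; exact t.mem_carrier_iff
  have hc : Continuous t.lin := LinearMap.continuous_of_finiteDimensional _
  rw [h]
  exact (isClosed_Icc.preimage (by fun_prop)).inter (isClosed_Icc.preimage (by fun_prop))

theorem convex_carrier : Convex ℝ t.carrier := by
  intro x hx y hy a b ha hb hab
  have h : a • x + b • y - t.base = a • (x - t.base) + b • (y - t.base) := by
    rw [smul_sub, smul_sub, show a = 1 - b by linarith, sub_smul, sub_smul, one_smul, one_smul]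
    ring
  rw [mem_carrier_iff] at *
  simp only [h, map_add, map_smul, Pi.add_apply, Pi.smul_apply]
  exact ⟨convex_Icc 0 1 hx.1 hy.1 ha hb hab, convex_Icc 0 1 hx.2 hy.2 ha hb hab⟩

theorem base_mem : t.base ∈ t.carrier := by
  rw [mem_carrier_iff]; simp

/-- The centre of the rhombus. -/
noncomputable def center : ℂ := t.base + (1 / 2 : ℝ) * v t.i + (1 / 2 : ℝ) * v t.j

theorem ball_center_subset : Metric.ball t.center (1 / 4) ⊆ t.carrier := by
  intro x hx
  rw [mem_ball_iff_norm] at hx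
  have h : x - t.base = (x - t.center) + ((1 / 2 : ℝ) * v t.i + (1 / 2 : ℝ) * v t.j) := by
    simp only [center]; ring
  have hi := abs_le.1 (t.abs_lin_le (x - t.center) t.i)
  have hj := abs_le.1 (t.abs_lin_le (x - t.center) t.j)
  rw [mem_carrier_iff, h, map_add, lin_comb]
  simp only [Pi.add_apply, Pi.smul_apply, Pi.single_eq_same, Pi.single_eq_of_ne t.ne,
    Pi.single_eq_of_ne t.ne.symm, smul_eq_mul, Set.mem_Icc]
  refine ⟨⟨?_, ?_⟩, ?_, ?_⟩ <;> linarith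

theorem norm_sub_base_le {x : ℂ} (hx : x ∈ t.carrier) : ‖x - t.base‖ ≤ 2 := by
  obtain ⟨a, ha, b, hb, rfl⟩ := hx
  rw [show t.base + a * v t.i + b * v t.j - t.base = a * v t.i + b * v t.j by ring]
  refine (norm_add_le _ _).trans ?_
  rw [norm_mul, norm_mul, norm_v, norm_v, Complex.norm_real, Complex.norm_real, Real.norm_eq_abs,
    Real.norm_eq_abs, abs_of_nonneg ha.1, abs_of_nonneg hb.1]
  linarith [ha.2, hb.2]

theorem norm_center_sub_le {x : ℂ} (hx : x ∈ t.carrier) : ‖t.center - x‖ ≤ 4 := by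
  have h := t.norm_sub_base_le hx
  have h' := t.norm_sub_base_le
    (t.ball_center_subset (Metric.mem_ball_self (by norm_num : (0 : ℝ) < 1 / 4)))
  calc ‖t.center - x‖ = ‖(t.center - t.base) - (x - t.base)‖ := by congr 1; ring
    _ ≤ _ := norm_sub_le _ _
    _ ≤ 4 := by linarith

theorem lin_v_self {k : Fin 4} (h : k = t.i ∨ k = t.j) : t.lin (v k) = Pi.single k 1 := by
  rcases h with rfl | rfl
  · exact t.lin_v_i
  · exact t.lin_v_j

theorem mem_edges_snd {q : (Fin 4 → ℤ) × Fin 4} (h : q ∈ t.edges) : q.2 = t.i ∨ q.2 = t.j := by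
  rcases h with rfl | rfl | rfl | rfl <;> simp

end Tile

/-! ### Intersections of tiles and local finiteness of a tiling. -/

theorem exists_sub_eq_of_mem_segment {p w x y : ℂ} (hx : x ∈ segment ℝ p (p + w))
    (hy : y ∈ segment ℝ p (p + w)) : ∃ c : ℝ, y - x = c * w := by
  rw [segment_eq_image'] at hx hy
  obtain ⟨a, -, rfl⟩ := hx
  obtain ⟨b, -, rfl⟩ := hy
  refine ⟨b - a, ?_⟩
  simp only [Complex.real_smul]
  push_cast
  ring

theorem IsTiling.exists_parallel {T : Set Tile} (hT : IsTiling T) {s t : Tile} (hs : s ∈ T)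
    (ht : t ∈ T) (hst : s ≠ t) {x : ℂ} (hxs : x ∈ s.carrier) (hxt : x ∈ t.carrier) :
    ∃ k l, (k = s.i ∨ k = s.j) ∧ (l = t.i ∨ l = t.j) ∧ ∀ y ∈ s.carrier ∩ t.carrier,
      ∀ z ∈ s.carrier ∩ t.carrier, (∃ c : ℝ, z - y = c * v k) ∧ ∃ c : ℝ, z - y = c * v l := by
  rcases hT.2 s hs t ht hst with h | ⟨p, -, h⟩ | ⟨⟨q, hq, h⟩, ⟨q', hq', h'⟩⟩
  · exact absurd (show x ∈ s.carrier ∩ t.carrier from ⟨hxs, hxt⟩) (by rw [h]; simp)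
  · refine ⟨s.i, t.i, .inl rfl, .inl rfl, fun y hy z hz => ?_⟩
    rw [h] at hy hz
    rw [Set.mem_singleton_iff.1 hy, Set.mem_singleton_iff.1 hz]
    exact ⟨⟨0, by simp⟩, ⟨0, by simp⟩⟩
  · refine ⟨q.2, q'.2, s.mem_edges_snd hq, t.mem_edges_snd hq', fun y hy z hz => ⟨?_, ?_⟩⟩
    · rw [h] at hy hz
      exact exists_sub_eq_of_mem_segment hy hz
    · rw [h'] at hy hz
      exact exists_sub_eq_of_mem_segment hy hz

/-- For distinct tiles `y - x` is parallel to an edge of each. If the two directions agree, both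
lifts send `v k` to the same basis vector; otherwise `y - x = 0`. -/
theorem IsTiling.lin_eq {T : Set Tile} (hT : IsTiling T) {s t : Tile} (hs : s ∈ T) (ht : t ∈ T)
    {x y : ℂ} (hxs : x ∈ s.carrier) (hxt : x ∈ t.carrier) (hys : y ∈ s.carrier)
    (hyt : y ∈ t.carrier) : s.lin (y - x) = t.lin (y - x) := by
  by_cases hst : s = t
  · rw [hst]
  obtain ⟨k, l, hk, hl, h⟩ := hT.exists_parallel hs ht hst hxs hxt
  obtain ⟨⟨c, hc⟩, ⟨d, hd⟩⟩ := h x ⟨hxs, hxt⟩ y ⟨hys, hyt⟩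
  by_cases hkl : k = l
  · subst hkl
    rw [hc, Tile.lin_mul, Tile.lin_mul, s.lin_v_self hk, t.lin_v_self hl]
  · have h0 : c * cr (v k) (v l) = 0 := by
      rw [← cr_smul_left, ← hc, hd, cr_smul_left, cr_self, mul_zero]
    have : c = 0 := by simpa [cr_ne_zero hkl] using h0
    rw [hc, this]; simp

/-- Two distinct tiles meet inside a line, whereas overlapping balls would share a short segment
transverse to that line. -/
theorem IsTiling.disjoint_ball {T : Set Tile} (hT : IsTiling T) {s t : Tile} (hs : s ∈ T)
    (ht : t ∈ T) (hst : s ≠ t) :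
    Disjoint (Metric.ball s.center (1 / 4)) (Metric.ball t.center (1 / 4)) := by
  rw [Set.disjoint_left]
  intro x hxs hxt
  obtain ⟨k, l, -, -, h⟩ := hT.exists_parallel hs ht hst (s.ball_center_subset hxs)
    (t.ball_center_subset hxt)
  obtain ⟨m, hm⟩ := exists_ne k
  have hO : IsOpen (Metric.ball s.center (1 / 4) ∩ Metric.ball t.center (1 / 4)) :=
    Metric.isOpen_ball.inter Metric.isOpen_ball
  have hc : Tendsto (fun c : ℝ => x + c * v m) (𝓝 0) (𝓝 x) := by
    have : Continuous fun c : ℝ => x + c * v m := by fun_prop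
    simpa using this.tendsto 0
  have h1 := hc.eventually (hO.mem_nhds ⟨hxs, hxt⟩)
  obtain ⟨ε, hε, h2⟩ := Metric.eventually_nhds_iff.1 h1
  have h3 := @h2 (ε / 2) (by rw [dist_zero_right, Real.norm_eq_abs, abs_of_pos (half_pos hε)]; linarith)
  obtain ⟨⟨c, hc⟩, -⟩ := h x ⟨s.ball_center_subset hxs, t.ball_center_subset hxt⟩ _
    ⟨s.ball_center_subset h3.1, t.ball_center_subset h3.2⟩
  rw [add_sub_cancel_left] at hc
  have h0 : ε / 2 * cr (v m) (v k) = 0 := by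
    rw [← cr_smul_left, hc, cr_smul_left, cr_self, mul_zero]
  rcases mul_eq_zero.1 h0 with h0 | h0
  · linarith
  · exact cr_ne_zero hm h0

theorem IsTiling.countable {T : Set Tile} (hT : IsTiling T) : T.Countable :=
  Set.PairwiseDisjoint.countable_of_isOpen (s := fun t : Tile => Metric.ball t.center (1 / 4))
    (fun _ hs _ ht hst => hT.disjoint_ball hs ht hst) (fun _ _ => Metric.isOpen_ball)
    (fun t _ => ⟨t.center, Metric.mem_ball_self (by norm_num)⟩)

/-- A packing argument: the tiles in question contain disjoint balls of the same area, all inside a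
ball of radius `6 > 1/4 + 4 + 1`. -/
theorem IsTiling.finite_near {T : Set Tile} (hT : IsTiling T) (x : ℂ) :
    {t | t ∈ T ∧ (t.carrier ∩ Metric.ball x 1).Nonempty}.Finite := by
  set A := {t | t ∈ T ∧ (t.carrier ∩ Metric.ball x 1).Nonempty} with hA
  have hd : Pairwise (Function.onFun Disjoint
      fun t : A => Metric.ball t.1.center (1 / 4)) := fun s t hst =>
    hT.disjoint_ball s.2.1 t.2.1 fun h => hst (Subtype.ext h)
  have hu : MeasureTheory.volume (⋃ t : A, Metric.ball t.1.center (1 / 4)) ≠ ⊤ := by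
    refine ne_top_of_le_ne_top (MeasureTheory.measure_ball_lt_top (x := x) (r := 6)).ne
      (MeasureTheory.measure_mono (Set.iUnion_subset fun t y hy => ?_))
    obtain ⟨-, z, hzt, hzx⟩ := t.2
    have h1 := t.1.norm_center_sub_le hzt
    rw [mem_ball_iff_norm] at *
    calc ‖y - x‖ = ‖(y - t.1.center) + (t.1.center - z) + (z - x)‖ := by congr 1; ring
      _ ≤ ‖y - t.1.center‖ + ‖t.1.center - z‖ + ‖z - x‖ := norm_add₃_le
      _ < 6 := by linarith
  have h := MeasureTheory.Measure.finite_const_le_meas_of_disjoint_iUnion MeasureTheory.volume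
    (ε := MeasureTheory.volume (Metric.ball (0 : ℂ) (1 / 4)))
    (Metric.measure_ball_pos _ _ (by norm_num)) (fun _ => Metric.isOpen_ball.measurableSet) hd hu
  have h' : {t : A | MeasureTheory.volume (Metric.ball (0 : ℂ) (1 / 4)) ≤
      MeasureTheory.volume (Metric.ball t.1.center (1 / 4))} = Set.univ :=
    Set.eq_univ_of_forall fun t =>
      (MeasureTheory.Measure.addHaar_ball_center MeasureTheory.volume t.1.center (1 / 4)).ge
  rw [h', Set.finite_univ_iff] at h
  exact Set.toFinite A

/-- Every point has a neighbourhood that meets only the tiles through this point. -/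
theorem IsTiling.eventually_mem {T : Set Tile} (hT : IsTiling T) (x : ℂ) :
    ∀ᶠ y in 𝓝 x, ∀ t ∈ T, y ∈ t.carrier → x ∈ t.carrier := by
  have h1 : ∀ᶠ y in 𝓝 x, ∀ t ∈ {t | t ∈ T ∧ (t.carrier ∩ Metric.ball x 1).Nonempty},
      y ∈ t.carrier → x ∈ t.carrier := by
    rw [(hT.finite_near x).eventually_all]
    intro t _
    by_cases hx : x ∈ t.carrier
    · exact Eventually.of_forall fun _ _ => hx
    · filter_upwards [t.isClosed_carrier.isOpen_compl.mem_nhds hx] with y hy hy'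
      exact absurd hy' hy
  filter_upwards [h1, Metric.ball_mem_nhds x one_pos] with y hy hyx t ht hyt
  exact hy t ⟨ht, y, hyt, hyx⟩ hyt

theorem IsTiling.exists_tile {T : Set Tile} (hT : IsTiling T) (x : ℂ) :
    ∃ t ∈ T, x ∈ t.carrier := by
  have : x ∈ ⋃ t ∈ T, t.carrier := by rw [hT.1]; trivial
  simpa using this

theorem IsTiling.eventually_common {T : Set Tile} (hT : IsTiling T) (x : ℂ) :
    ∀ᶠ y in 𝓝 x, ∃ t ∈ T, x ∈ t.carrier ∧ y ∈ t.carrier := by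
  filter_upwards [hT.eventually_mem x] with y hy
  obtain ⟨t, ht, hyt⟩ := hT.exists_tile y
  exact ⟨t, ht, hy t ht hyt, hyt⟩

/-! ### The height function: existence, slopes and reconstruction of the plane. -/

/-- A height function: the lift of the tiling, as a map from the plane to `ℝ⁴`. -/
def IsHeight (T : Set Tile) (h : ℂ → Fin 4 → ℝ) : Prop :=
  ∀ t ∈ T, ∀ x ∈ t.carrier, ∀ y ∈ t.carrier, h y = h x + t.lin (y - x)

theorem eq_of_eventually_eq {X Y : Type*} [TopologicalSpace X] {f : X → Y} {s : Set X}
    (hs : IsPreconnected s) (hf : ∀ x ∈ s, ∀ᶠ z in 𝓝[s] x, f z = f x) {x y : X} (hx : x ∈ s)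
    (hy : y ∈ s) : f x = f y := by
  have : PreconnectedSpace s := isPreconnected_iff_preconnectedSpace.1 hs
  have hl : IsLocallyConstant (fun z : s => f z) := by
    rw [IsLocallyConstant.iff_eventually_eq]
    rintro ⟨z, hz⟩
    have h := hf z hz
    rw [eventually_nhdsWithin_iff] at h
    rw [nhds_subtype_eq_comap, eventually_comap]
    filter_upwards [h] with w hw u hu
    subst hu
    exact hw u.2
  exact hl.apply_eq_of_preconnectedSpace ⟨x, hx⟩ ⟨y, hy⟩

theorem IsTiling.exists_height {T : Set Tile} (hT : IsTiling T) : ∃ h, IsHeight T h := by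
  classical
  -- By `IsTiling.lin_eq` the value does not depend on the chosen tile. The default `0` is harmless:
  -- points close to `x` share a tile with `x`.
  let G : ℂ → ℂ → Fin 4 → ℝ := fun x y =>
    if H : ∃ t ∈ T, x ∈ t.carrier ∧ y ∈ t.carrier then H.choose.lin (y - x) else 0
  have hG : ∀ t ∈ T, ∀ x ∈ t.carrier, ∀ y ∈ t.carrier, G x y = t.lin (y - x) := by
    intro t ht x hx y hy
    have H : ∃ t ∈ T, x ∈ t.carrier ∧ y ∈ t.carrier := ⟨t, ht, hx, hy⟩
    have h : G x y = H.choose.lin (y - x) := dif_pos H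
    have h' := H.choose_spec
    rw [h]
    exact hT.lin_eq h'.1 ht h'.2.1 hx h'.2.2 hy
  obtain ⟨h, hh⟩ := exists_potential G fun x => by
    obtain ⟨U, hU, hUo, hxU⟩ := eventually_nhds_iff.1 (hT.eventually_mem x)
    refine ⟨U, hUo, hxU, fun y hy => ?_⟩
    filter_upwards [hT.eventually_common y, hUo.mem_nhds hy] with z hz hzU
    obtain ⟨t, ht, hyt, hzt⟩ := hz
    have hxt := hU z hzU t ht hzt
    rw [hG t ht y hyt z hzt, hG t ht x hxt z hzt, hG t ht x hxt y hyt, ← map_sub]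
    congr 1
    ring
  refine ⟨h, fun t ht x hx y hy => ?_⟩
  -- The potential is controlled only near each point; connectedness of the tile carries this over
  -- the whole tile.
  have key : h x - t.lin x = h y - t.lin y := by
    refine eq_of_eventually_eq (f := fun z => h z - t.lin z) t.convex_carrier.isPreconnected
      (fun z hz => ?_) hx hy
    filter_upwards [nhdsWithin_le_nhds (hh z), self_mem_nhdsWithin] with w hw hwt
    rw [hw, hG t ht z hz w hwt, map_sub]
    abel
  rw [map_sub, eq_sub_iff_add_eq.1 key.symm |>.symm]
  abel

/-- Continuous induction on `[a, b]`. Only slopes to the right are needed, so the lines along which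
heights are measured may cross edges and vertices freely. -/
theorem sub_le_mul_of_eventually {f : ℝ → ℝ} (hf : Continuous f) {C : ℝ}
    (h : ∀ t, ∀ᶠ u in 𝓝[>] t, f u - f t ≤ C * (u - t)) {a b : ℝ} (hab : a ≤ b) :
    f b - f a ≤ C * (b - a) := by
  have key : Set.Icc a b ⊆ {u | f u - f a ≤ C * (u - a)} := by
    refine IsClosed.Icc_subset_of_forall_exists_gt ?_ ?_ ?_
    · exact (isClosed_le (by fun_prop) (by fun_prop)).inter isClosed_Icc
    · change f a - f a ≤ C * (a - a)
      simp
    · rintro x ⟨hx, -⟩ y hy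
      have h1 : ∀ᶠ u in 𝓝[>] x, u ∈ Set.Ioc x y :=
        Ioc_mem_nhdsGT hy
      obtain ⟨u, hu1, hu2⟩ := ((h x).and h1).exists
      refine ⟨u, ?_, hu2⟩
      change f x - f a ≤ C * (x - a) at hx
      change f u - f a ≤ C * (u - a)
      linarith
  exact key ⟨hab, le_rfl⟩

namespace IsHeight

variable {T : Set Tile} {h : ℂ → Fin 4 → ℝ}

theorem eventually_lin (hh : IsHeight T h) (hT : IsTiling T) (x : ℂ) :
    ∀ᶠ y in 𝓝 x, ∃ t ∈ T, h y = h x + t.lin (y - x) := by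
  filter_upwards [hT.eventually_common x] with y ⟨t, ht, hx, hy⟩
  exact ⟨t, ht, hh t ht x hx y hy⟩

theorem continuous (hh : IsHeight T h) (hT : IsTiling T) (k : Fin 4) :
    Continuous fun x => h x k := by
  rw [continuous_iff_continuousAt]
  intro x
  have h0 : Tendsto (fun y => 2 * ‖y - x‖) (𝓝 x) (𝓝 0) := by
    have : Continuous fun y => 2 * ‖y - x‖ := by fun_prop
    simpa using this.tendsto x
  refine tendsto_iff_dist_tendsto_zero.2 (squeeze_zero' (Eventually.of_forall fun _ => dist_nonneg)
    ?_ h0)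
  filter_upwards [hh.eventually_lin hT x] with y ⟨t, _, hy⟩
  rw [hy, Real.dist_eq, Pi.add_apply, add_sub_cancel_left]
  exact t.abs_lin_le _ _

/-- The factor `c`, taken to be `1` or `-1`, yields upper and lower bounds on slopes at once. -/
theorem sub_le_along (hh : IsHeight T h) (hT : IsTiling T) (k : Fin 4) (x w : ℂ) {c C : ℝ}
    (hC : ∀ t ∈ T, c * t.lin w k ≤ C) {r : ℝ} (hr : 0 ≤ r) :
    c * (h (x + r * w) k - h x k) ≤ C * r := by
  have hl : Continuous fun u : ℝ => x + u * w := by fun_prop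
  have hf : Continuous fun u : ℝ => c * h (x + u * w) k :=
    continuous_const.mul ((hh.continuous hT k).comp hl)
  have := sub_le_mul_of_eventually hf (C := C) (fun t => ?_) hr
  · simpa [mul_sub] using this
  · filter_upwards [nhdsWithin_le_nhds (hl.continuousAt.eventually (hh.eventually_lin hT _)),
      self_mem_nhdsWithin] with u ⟨s, hs, hu⟩ hut
    have e1 : x + u * w - (x + t * w) = ((u - t : ℝ) : ℂ) * w := by push_cast; ring
    rw [hu, e1, Tile.lin_mul, Pi.add_apply, Pi.smul_apply, smul_eq_mul]
    have h1 : 0 ≤ u - t := sub_nonneg.2 (le_of_lt hut)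
    nlinarith [hC s hs]

theorem abs_sub_le (hh : IsHeight T h) (hT : IsTiling T) (k : Fin 4) (x y : ℂ) :
    |h y k - h x k| ≤ 2 * ‖y - x‖ := by
  have h1 := hh.sub_le_along hT k x (y - x) (c := 1) (C := 2 * ‖y - x‖)
    (fun t _ => by linarith [(abs_le.1 (t.abs_lin_le (y - x) k)).2]) zero_le_one
  have h2 := hh.sub_le_along hT k x (y - x) (c := -1) (C := 2 * ‖y - x‖)
    (fun t _ => by linarith [(abs_le.1 (t.abs_lin_le (y - x) k)).1]) zero_le_one
  simp only [Complex.ofReal_one, one_mul, add_sub_cancel] at h1 h2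
  exact abs_le.2 ⟨by linarith, by linarith⟩

end IsHeight

theorem Tile.lin_v_mem (t : Tile) (k : Fin 4) : t.lin (v k) k = 0 ∨ t.lin (v k) k = 1 := by
  by_cases h : k = t.i ∨ k = t.j
  · right; rw [t.lin_v_self h, Pi.single_eq_same]
  · rw [not_or] at h
    left; exact t.lin_of_ne h.1 h.2 _

namespace IsHeight

variable {T : Set Tile} {h : ℂ → Fin 4 → ℝ}

theorem sub_le_v (hh : IsHeight T h) (hT : IsTiling T) (k : Fin 4) (x : ℂ) {r : ℝ} (hr : 0 ≤ r) :
    h (x + r * v k) k - h x k ≤ r := by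
  have := hh.sub_le_along hT k x (v k) (c := 1) (C := 1)
    (fun t _ => by rcases t.lin_v_mem k with e | e <;> rw [e] <;> norm_num) hr
  linarith

theorem le_v (hh : IsHeight T h) (hT : IsTiling T) (k : Fin 4) (x : ℂ) {r : ℝ} (hr : 0 ≤ r) :
    h x k ≤ h (x + r * v k) k := by
  have := hh.sub_le_along hT k x (v k) (c := -1) (C := 0)
    (fun t _ => by rcases t.lin_v_mem k with e | e <;> rw [e] <;> norm_num) hr
  linarith

theorem sum_eq (hh : IsHeight T h) (hT : IsTiling T) (x : ℂ) :
    ∑ k, ((h x k - h 0 k : ℝ) : ℂ) * v k = x := by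
  have key : (∑ k, (h x k : ℂ) * v k) - x = (∑ k, (h 0 k : ℂ) * v k) - 0 := by
    refine eq_of_eventually_eq (f := fun z => (∑ k, (h z k : ℂ) * v k) - z)
      isPreconnected_univ (fun z _ => ?_) (Set.mem_univ x) (Set.mem_univ 0)
    filter_upwards [nhdsWithin_le_nhds (hh.eventually_lin hT z)] with w ⟨t, _, hw⟩
    rw [hw]
    simp only [Pi.add_apply, Complex.ofReal_add, add_mul, Finset.sum_add_distrib, t.sum_lin]
    ring
  simp only [Complex.ofReal_sub, sub_mul, Finset.sum_sub_distrib]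
  linear_combination key

end IsHeight

/-! ### Ammann bars of a single notched tile. -/

theorem inner_eq (z w : ℂ) : inner ℝ z w = z.re * w.re + z.im * w.im := by
  simp [Complex.inner]; ring

theorem inner_v_mem {i j : Fin 4} (h : i < j) :
    inner ℝ (v i) (v j) = √2 / 2 ∨ inner ℝ (v i) (v j) = 0 ∨ inner ℝ (v i) (v j) = -(√2 / 2) := by
  fin_cases i <;> fin_cases j <;>
    first
    | exact absurd h (by decide)
    | (simp only [inner_eq, Fin.zero_eta, Fin.mk_one, Fin.reduceFinMk, v_zero, v_one, v_two,
        v_three]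
       ring_nf
       simp)

/-- The position of the Ammann bar carried by the edge `[p, p + v k]`, along the axis `v k`. -/
noncomputable def level (σ : ℂ → Fin 4 → Bool) (p : ℂ) (k : Fin 4) : ℝ :=
  inner ℝ p (v k) + if σ p k then √2 / 2 else 0

theorem proj_e (k : Fin 4) : proj (e k) = v k := by
  simp [proj, e, Pi.single_apply]

theorem proj_zero : proj 0 = 0 := by simp [proj]

namespace Tile

variable {t : Tile} {σ : ℂ → Fin 4 → Bool}

/-- The one place where the notches enter: the shift of `⟪p, v k⟫` between opposite edges is
cancelled by the flip of the arrow in a rhombus, and both are absent in a square. -/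
theorem IsNotched.level_eq (ht : t.IsNotched σ) {d : Fin 4 → ℤ} {k : Fin 4}
    (h : (d, k) ∈ t.edges) : level σ (t.edgeStart d) k = level σ t.base k := by
  have hpos : 0 < √2 / 2 := by positivity
  have key : level σ (t.base + v t.j) t.i = level σ t.base t.i ∧
      level σ (t.base + v t.i) t.j = level σ t.base t.j := by
    have hc : inner ℝ (v t.j) (v t.i) = inner ℝ (v t.i) (v t.j) := real_inner_comm _ _
    simp only [level, inner_add_left, hc]
    rcases inner_v_mem t.lt with h | h | h
    · obtain ⟨h1, h2, h3, h4⟩ := ht.1 (by rw [h]; exact hpos)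
      rw [h, h1, h2, h3, h4]
      constructor <;> simp
    · obtain ⟨h1, h2⟩ := ht.2.2 h
      rw [h, h1, h2]
      constructor <;> simp
    · obtain ⟨h1, h2, h3, h4⟩ := ht.2.1 (by rw [h]; linarith)
      rw [h, h1, h2, h3, h4]
      constructor <;> simp
  rcases h with h | h | h | h <;> obtain ⟨rfl, rfl⟩ := Prod.mk.inj h
  · rw [edgeStart, proj_zero, add_zero]
  · rw [edgeStart, proj_e]; exact key.1
  · rw [edgeStart, proj_zero, add_zero]
  · rw [edgeStart, proj_e]; exact key.2

theorem lin_mem_of_vertex (t : Tile) {p : ℂ} (hp : p ∈ t.vertices) (k : Fin 4) :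
    t.lin (p - t.base) k = 0 ∨ t.lin (p - t.base) k = 1 := by
  rcases hp with rfl | rfl | rfl | rfl
  · simp
  · rw [add_sub_cancel_left, lin_v_i, Pi.single_apply]; split_ifs <;> simp
  · rw [add_sub_cancel_left, lin_v_j, Pi.single_apply]; split_ifs <;> simp
  · rw [add_assoc, add_sub_cancel_left, map_add, lin_v_i, lin_v_j, Pi.add_apply, Pi.single_apply,
      Pi.single_apply]
    split_ifs with h1 h2
    · exact absurd (h1.symm.trans h2) t.ne
    all_goals simp

theorem lin_mem_of_edge (t : Tile) {d : Fin 4 → ℤ} {k l : Fin 4} (h : (d, l) ∈ t.edges)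
    (hkl : k ≠ l) {x : ℂ} (hx : x ∈ segment ℝ (t.edgeStart d) (t.edgeStart d + v l)) :
    t.lin (x - t.base) k = 0 ∨ t.lin (x - t.base) k = 1 := by
  obtain ⟨c, hc⟩ := exists_sub_eq_of_mem_segment (left_mem_segment ℝ _ _) hx
  have e1 : x - t.base = proj d + c * v l := by
    rw [← hc, edgeStart]; ring
  have hl := t.mem_edges_snd h
  rw [e1, map_add, lin_mul, t.lin_v_self hl, Pi.add_apply, Pi.smul_apply, Pi.single_eq_of_ne hkl,
    smul_zero, add_zero]
  rcases h with h | h | h | h <;> obtain ⟨rfl, rfl⟩ := Prod.mk.inj h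
  · simp [proj_zero]
  · rw [proj_e, lin_v_j, Pi.single_apply]; split_ifs <;> simp
  · simp [proj_zero]
  · rw [proj_e, lin_v_i, Pi.single_apply]; split_ifs <;> simp

end Tile

theorem start_eq_of_segment_eq {p q : ℂ} {k : Fin 4}
    (h : segment ℝ p (p + v k) = segment ℝ q (q + v k)) : p = q := by
  have h1 : p ∈ segment ℝ q (q + v k) := h ▸ left_mem_segment ℝ _ _
  have h2 : q ∈ segment ℝ p (p + v k) := h.symm ▸ left_mem_segment ℝ _ _
  rw [segment_eq_image'] at h1 h2
  obtain ⟨a, ha, rfl⟩ := h1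
  obtain ⟨b, hb, h2⟩ := h2
  have h3 : ((b + a : ℝ) : ℂ) * v k = 0 := by
    simp only [Complex.real_smul, add_sub_cancel_left] at h2
    push_cast
    linear_combination h2
  rcases mul_eq_zero.1 h3 with h3 | h3
  · have : a = 0 := by linarith [ha.1, hb.1, Complex.ofReal_eq_zero.1 h3]
    simp [this]
  · exact absurd h3 (v_ne_zero k)

/-! ### Rows of tiles at a generic height, and how they follow their Ammann bars. -/

/-- A value that the `k`-th coordinate of the height function takes neither at a vertex nor on a
tile without an edge of direction `v k`. -/
def IsGeneric (T : Set Tile) (h : ℂ → Fin 4 → ℝ) (k : Fin 4) (θ : ℝ) : Prop :=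
  ∀ t ∈ T, θ ≠ h t.base k ∧ θ ≠ h t.base k + 1

theorem IsTiling.exists_generic {T : Set Tile} (hT : IsTiling T) (h : ℂ → Fin 4 → ℝ) (k : Fin 4)
    {a b : ℝ} (hab : a < b) : ∃ θ ∈ Set.Ioo a b, IsGeneric T h k θ := by
  have hc : ((fun t : Tile => h t.base k) '' T ∪ (fun t : Tile => h t.base k + 1) '' T).Countable :=
    (hT.countable.image _).union (hT.countable.image _)
  obtain ⟨θ, hθ, hab⟩ := (hc.dense_compl ℝ).exists_mem_open isOpen_Ioo (Set.nonempty_Ioo.2 hab)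
  exact ⟨θ, hab, fun t ht => ⟨fun e => hθ (.inl ⟨t, ht, e.symm⟩), fun e => hθ (.inr ⟨t, ht, e.symm⟩)⟩⟩

section Level

variable {T : Set Tile} {h : ℂ → Fin 4 → ℝ} {k : Fin 4} {θ : ℝ} {σ : ℂ → Fin 4 → Bool}

theorem IsHeight.lin_ne (hh : IsHeight T h) (hθ : IsGeneric T h k θ) {t : Tile} (ht : t ∈ T)
    {x : ℂ} (hx : x ∈ t.carrier) (hxθ : h x k = θ) :
    ¬(t.lin (x - t.base) k = 0 ∨ t.lin (x - t.base) k = 1) := by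
  have e1 := congrFun (hh t ht _ t.base_mem x hx) k
  rw [Pi.add_apply, hxθ] at e1
  rintro (h0 | h1)
  · exact (hθ t ht).1 (by rw [e1, h0, add_zero])
  · exact (hθ t ht).2 (by rw [e1, h1])

theorem IsHeight.mem_dir (hh : IsHeight T h) (hθ : IsGeneric T h k θ) {t : Tile} (ht : t ∈ T)
    {x : ℂ} (hx : x ∈ t.carrier) (hxθ : h x k = θ) : k = t.i ∨ k = t.j := by
  by_contra hk
  rw [not_or] at hk
  exact hh.lin_ne hθ ht hx hxθ (.inl (t.lin_of_ne hk.1 hk.2 _))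

/-- Vertices and edges of other directions have `k`-th coordinate `0` or `1` relative to the base,
which genericity excludes. So the two tiles share an edge of direction `v k`, and that edge has a
single level. -/
theorem IsHeight.level_eq (hh : IsHeight T h) (hT : IsTiling T) (hσ : ∀ t ∈ T, t.IsNotched σ)
    (hθ : IsGeneric T h k θ) {s t : Tile} (hs : s ∈ T) (ht : t ∈ T) {x : ℂ} (hxs : x ∈ s.carrier)
    (hxt : x ∈ t.carrier) (hxθ : h x k = θ) : level σ s.base k = level σ t.base k := by
  by_cases hst : s = t
  · rw [hst]
  have hx : x ∈ s.carrier ∩ t.carrier := ⟨hxs, hxt⟩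
  rcases hT.2 s hs t ht hst with H | ⟨p, hp, H⟩ | ⟨⟨⟨d, l⟩, hq, H⟩, ⟨⟨d', l'⟩, hq', H'⟩⟩
  · rw [H] at hx; exact hx.elim
  · rw [H] at hx
    rw [← Set.mem_singleton_iff.1 hx] at hp
    exact absurd (s.lin_mem_of_vertex hp.1 k) (hh.lin_ne hθ hs hxs hxθ)
  · have hl : k = l := by
      by_contra hkl
      exact hh.lin_ne hθ hs hxs hxθ (s.lin_mem_of_edge hq hkl (H ▸ hx))
    have hl' : k = l' := by
      by_contra hkl
      exact hh.lin_ne hθ ht hxt hxθ (t.lin_mem_of_edge hq' hkl (H' ▸ hx))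
    subst hl hl'
    rw [← (hσ s hs).level_eq hq, ← (hσ t ht).level_eq hq', start_eq_of_segment_eq (H.symm.trans H')]

/-- The point `x` is at height `θ`, on a row of tiles whose Ammann bar is at position `m`. -/
def OnBar (T : Set Tile) (h : ℂ → Fin 4 → ℝ) (σ : ℂ → Fin 4 → Bool) (k : Fin 4) (θ m : ℝ)
    (x : ℂ) : Prop :=
  h x k = θ ∧ ∀ t ∈ T, x ∈ t.carrier → level σ t.base k = m

theorem IsHeight.exists_onBar (hh : IsHeight T h) (hT : IsTiling T)
    (hσ : ∀ t ∈ T, t.IsNotched σ) (hθ : IsGeneric T h k θ) {x : ℂ} (hx : h x k = θ) :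
    ∃ m, OnBar T h σ k θ m x := by
  obtain ⟨t, ht, hxt⟩ := hT.exists_tile x
  exact ⟨level σ t.base k, hx, fun s hs hxs => hh.level_eq hT hσ hθ hs ht hxs hxt hx⟩

theorem IsHeight.eventually_onBar_iff (hh : IsHeight T h) (hT : IsTiling T)
    (hσ : ∀ t ∈ T, t.IsNotched σ) (hθ : IsGeneric T h k θ) {x : ℂ} (hx : h x k = θ) (m : ℝ) :
    ∀ᶠ y in 𝓝 x, h y k = θ → (OnBar T h σ k θ m y ↔ OnBar T h σ k θ m x) := by
  filter_upwards [hT.eventually_mem x] with y hy hyθ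
  refine ⟨fun ⟨_, H⟩ => ⟨hx, fun s hs hxs => ?_⟩, fun ⟨_, H⟩ => ⟨hyθ, fun s hs hys =>
    H s hs (hy s hs hys)⟩⟩
  obtain ⟨t, ht, hyt⟩ := hT.exists_tile y
  rw [← H t ht hyt]
  exact hh.level_eq hT hσ hθ hs ht hxs (hy t ht hyt) hx

theorem IsHeight.isClosed_onBar (hh : IsHeight T h) (hT : IsTiling T)
    (hσ : ∀ t ∈ T, t.IsNotched σ) (hθ : IsGeneric T h k θ) (m : ℝ) :
    IsClosed {x | OnBar T h σ k θ m x} := by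
  rw [← isOpen_compl_iff, isOpen_iff_mem_nhds]
  intro x hx
  by_cases hxθ : h x k = θ
  · filter_upwards [hh.eventually_onBar_iff hT hσ hθ hxθ m] with y hy hyb
    exact hx ((hy hyb.1).1 hyb)
  · have hO : IsOpen {y | h y k ≠ θ} := isOpen_ne_fun (hh.continuous hT k) continuous_const
    filter_upwards [hO.mem_nhds hxθ] with y hy hyb
    exact hy hyb.1

/-- The base of a tile through `x` is within `2` of `x`, and the offset in `level` is at most `√2 /
2 ≤ 1`. -/
theorem OnBar.abs_sub_le (hT : IsTiling T) {m : ℝ} {x : ℂ} (hx : OnBar T h σ k θ m x) :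
    |inner ℝ x (v k) - m| ≤ 3 := by
  obtain ⟨t, ht, hxt⟩ := hT.exists_tile x
  have h1 := t.norm_sub_base_le hxt
  have h2 : |inner ℝ (x - t.base) (v k)| ≤ 2 := by
    refine (abs_real_inner_le_norm _ _).trans ?_
    rw [norm_v, mul_one]; exact h1
  have h3 : √2 ≤ 2 := Real.sqrt_le_sqrt (by norm_num : (2 : ℝ) ≤ 4) |>.trans_eq (by
    rw [show (4 : ℝ) = 2 ^ 2 by norm_num, Real.sqrt_sq (by norm_num)])
  have h4 : 0 ≤ √2 := Real.sqrt_nonneg _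
  rw [← hx.2 t ht hxt, level]
  rw [inner_sub_left, abs_le] at h2
  rw [abs_le]
  split_ifs <;> constructor <;> linarith [h2.1, h2.2]

/-- Near a generic point, moving in the direction `v k` changes the `k`-th height at unit speed. -/
theorem IsHeight.eventually_add_v (hh : IsHeight T h) (hT : IsTiling T)
    (hθ : IsGeneric T h k θ) {x : ℂ} (hx : h x k = θ) :
    ∀ᶠ δ : ℝ in 𝓝 0, h (x + δ * v k) k = θ + δ := by
  obtain ⟨t, ht, hxt⟩ := hT.exists_tile x
  have hk := hh.mem_dir hθ ht hxt hx
  have hn := hh.lin_ne hθ ht hxt hx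
  rw [not_or] at hn
  have hxt' := t.mem_carrier_iff.1 hxt
  have hmem : t.lin (x - t.base) k ∈ Set.Icc (0 : ℝ) 1 := by
    rcases hk with rfl | rfl
    · exact hxt'.1
    · exact hxt'.2
  have h0 : 0 < t.lin (x - t.base) k := lt_of_le_of_ne hmem.1 (Ne.symm hn.1)
  have h1 : t.lin (x - t.base) k < 1 := lt_of_le_of_ne hmem.2 hn.2
  filter_upwards [Ioo_mem_nhds (neg_lt_zero.2 h0) (sub_pos.2 h1)] with δ hδ
  have e1 : ∀ l, t.lin (x + δ * v k - t.base) l =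
      t.lin (x - t.base) l + δ * (Pi.single k 1 : Fin 4 → ℝ) l := by
    intro l
    rw [show x + δ * v k - t.base = (x - t.base) + δ * v k by ring, map_add, Tile.lin_mul,
      t.lin_v_self hk]
    rfl
  have hy : x + δ * v k ∈ t.carrier := by
    rw [Tile.mem_carrier_iff, e1, e1]
    rcases hk with rfl | rfl
    · rw [Pi.single_eq_same, Pi.single_eq_of_ne t.ne.symm, mul_zero, add_zero]
      exact ⟨⟨by linarith [hδ.1], by linarith [hδ.2]⟩, hxt'.2⟩
    · rw [Pi.single_eq_same, Pi.single_eq_of_ne t.ne, mul_zero, add_zero]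
      exact ⟨hxt'.1, ⟨by linarith [hδ.1], by linarith [hδ.2]⟩⟩
  rw [hh t ht x hxt _ hy, add_sub_cancel_left, Tile.lin_mul, t.lin_v_self hk]
  simp [hx]

/-- The point with coordinate `s` along `v k`, and `r` along the perpendicular direction. -/
noncomputable def pt (k : Fin 4) (r s : ℝ) : ℂ := (s + r * Complex.I) * v k

theorem pt_add (k : Fin 4) (r s δ : ℝ) : pt k r (s + δ) = pt k r s + δ * v k := by
  simp only [pt]; push_cast; ring

theorem inner_pt (k : Fin 4) (r s : ℝ) : inner ℝ (pt k r s) (v k) = s := by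
  have h : (v k).re * (v k).re + (v k).im * (v k).im = 1 := by
    rw [← Complex.normSq_apply, ← Complex.sq_norm, norm_v, one_pow]
  rw [inner_eq]
  simp [pt]
  linear_combination s * h

theorem exists_pt (k : Fin 4) (x : ℂ) : ∃ r, x = pt k r (inner ℝ x (v k)) := by
  refine ⟨(x / v k).im, ?_⟩
  have h : x = pt k (x / v k).im (x / v k).re := by
    rw [pt, Complex.re_add_im, div_mul_cancel₀ _ (v_ne_zero k)]
  have h2 : inner ℝ x (v k) = (x / v k).re := by
    conv_lhs => rw [h]
    exact inner_pt _ _ _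
  rw [h2]; exact h

theorem continuous_pt (k : Fin 4) : Continuous fun q : ℝ × ℝ => pt k q.1 q.2 := by
  simp only [pt]; fun_prop

/-- The height crosses `θ` strictly along `v k`, so by the intermediate value theorem it still takes
the value `θ` over every nearby `r`, at a point close enough to lie on the same bar. -/
theorem IsHeight.isOpen_onBar (hh : IsHeight T h) (hT : IsTiling T)
    (hσ : ∀ t ∈ T, t.IsNotched σ) (hθ : IsGeneric T h k θ) (m : ℝ) :
    IsOpen {r | ∃ s, OnBar T h σ k θ m (pt k r s)} := by
  rw [isOpen_iff_mem_nhds]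
  rintro r₀ ⟨s₀, hb⟩
  have h1 := ((continuous_pt k).tendsto (r₀, s₀)).eventually
    (hh.eventually_onBar_iff hT hσ hθ hb.1 m)
  obtain ⟨ε, hε, h1⟩ := Metric.eventually_nhds_iff.1 h1
  obtain ⟨ε', hε', h2⟩ := Metric.eventually_nhds_iff.1 (hh.eventually_add_v hT hθ hb.1)
  obtain ⟨δ, hδ, hδε⟩ := exists_between (lt_min hε hε')
  have hδ1 : δ < ε := hδε.trans_le (min_le_left _ _)
  have hδ2 : δ < ε' := hδε.trans_le (min_le_right _ _)
  have hp := @h2 δ (by rw [dist_zero_right, Real.norm_eq_abs, abs_of_pos hδ]; exact hδ2)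
  have hm := @h2 (-δ) (by
    rw [dist_zero_right, Real.norm_eq_abs, abs_neg, abs_of_pos hδ]; exact hδ2)
  rw [← pt_add] at hp hm
  have hcont : ∀ s, Continuous fun r => h (pt k r s) k := fun s =>
    (hh.continuous hT k).comp ((continuous_pt k).comp (by fun_prop : Continuous fun r => (r, s)))
  have hcont' : ∀ r, Continuous fun s => h (pt k r s) k := fun r =>
    (hh.continuous hT k).comp ((continuous_pt k).comp (by fun_prop : Continuous fun s => (r, s)))
  have u1 : ∀ᶠ r in 𝓝 r₀, θ < h (pt k r (s₀ + δ)) k :=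
    (hcont _).continuousAt.eventually_const_lt (by simp only [hp]; linarith)
  have u2 : ∀ᶠ r in 𝓝 r₀, h (pt k r (s₀ + -δ)) k < θ :=
    (hcont _).continuousAt.eventually_lt_const (by simp only [hm]; linarith)
  filter_upwards [u1, u2, Metric.ball_mem_nhds r₀ hε] with r hr1 hr2 hr
  obtain ⟨s, hs, hsθ⟩ := intermediate_value_Icc (by linarith : s₀ + -δ ≤ s₀ + δ)
    (hcont' r).continuousOn ⟨hr2.le, hr1.le⟩
  refine ⟨s, (h1 (y := (r, s)) ?_ hsθ).2 hb⟩
  rw [Prod.dist_eq, max_lt_iff]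
  refine ⟨hr, lt_of_le_of_lt ?_ hδ1⟩
  rw [Real.dist_eq, abs_le]
  exact ⟨by linarith [hs.1], by linarith [hs.2]⟩

/-- A row cannot escape to infinity over a finite `r`: it stays within `3` of its bar, so
compactness gives a limit point. -/
theorem IsHeight.isClosed_proj_onBar (hh : IsHeight T h) (hT : IsTiling T)
    (hσ : ∀ t ∈ T, t.IsNotched σ) (hθ : IsGeneric T h k θ) (m : ℝ) :
    IsClosed {r | ∃ s, OnBar T h σ k θ m (pt k r s)} := by
  refine IsSeqClosed.isClosed fun u r hu hr => ?_
  choose s hs using hu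
  have hI : ∀ n, s n ∈ Set.Icc (m - 3) (m + 3) := fun n => by
    have := abs_le.1 ((hs n).abs_sub_le hT)
    rw [inner_pt] at this
    exact ⟨by linarith [this.1], by linarith [this.2]⟩
  obtain ⟨a, -, φ, hφ, ha⟩ := isCompact_Icc.tendsto_subseq hI
  refine ⟨a, (hh.isClosed_onBar hT hσ hθ m).mem_of_tendsto
    (((continuous_pt k).tendsto (r, a)).comp ((hr.comp hφ.tendsto_atTop).prodMk_nhds ha))
    (Eventually.of_forall fun n => hs (φ n))⟩

/-- A row of tiles follows its Ammann bar along the whole of a line perpendicular to `v k`. -/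
theorem IsHeight.exists_onBar_above (hh : IsHeight T h) (hT : IsTiling T)
    (hσ : ∀ t ∈ T, t.IsNotched σ) (hθ : IsGeneric T h k θ) {x : ℂ} (hx : h x k = θ) :
    ∃ m, ∀ r, ∃ s, |s - m| ≤ 3 ∧ h (pt k r s) k = θ := by
  obtain ⟨m, hm⟩ := hh.exists_onBar hT hσ hθ hx
  have hu : {r | ∃ s, OnBar T h σ k θ m (pt k r s)} = Set.univ := by
    refine IsClopen.eq_univ ⟨hh.isClosed_proj_onBar hT hσ hθ m, hh.isOpen_onBar hT hσ hθ m⟩ ?_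
    obtain ⟨r, hr⟩ := exists_pt k x
    exact ⟨r, inner ℝ x (v k), hr ▸ hm⟩
  refine ⟨m, fun r => ?_⟩
  obtain ⟨s, hs⟩ : r ∈ {r | ∃ s, OnBar T h σ k θ m (pt k r s)} := hu ▸ Set.mem_univ r
  have := hs.abs_sub_le hT
  rw [inner_pt] at this
  exact ⟨s, this, hs.1⟩

theorem IsHeight.pt_mono (hh : IsHeight T h) (hT : IsTiling T) (r : ℝ) {s s' : ℝ} (hs : s ≤ s') :
    h (pt k r s) k ≤ h (pt k r s') k ∧ h (pt k r s') k - h (pt k r s) k ≤ s' - s := by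
  have e1 : pt k r s' = pt k r s + (s' - s : ℝ) * v k := by rw [← pt_add, add_sub_cancel]
  rw [e1]
  exact ⟨hh.le_v hT k _ (sub_nonneg.2 hs), hh.sub_le_v hT k _ (sub_nonneg.2 hs)⟩

/-- If the two heights differ, a row at an intermediate generic height `θ` passes over `r` at some
`s₁ ≥ s` and over `r'` at some `s₂ ≤ s`. Slopes are at most `1`, so the difference is at most `s₁ -
s₂`, and both numbers lie within `3` of the bar. -/
theorem IsHeight.sub_le_six (hh : IsHeight T h) (hT : IsTiling T)
    (hσ : ∀ t ∈ T, t.IsNotched σ) (r r' s : ℝ) : h (pt k r' s) k - h (pt k r s) k ≤ 6 := by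
  by_contra! hlt
  have hab : h (pt k r s) k < h (pt k r' s) k := by linarith
  obtain ⟨θ, hθ, hg⟩ := hT.exists_generic h k hab
  have hcont : Continuous fun q => h (pt k q s) k :=
    (hh.continuous hT k).comp ((continuous_pt k).comp (by fun_prop : Continuous fun q => (q, s)))
  obtain ⟨q, hq⟩ := mem_range_of_exists_le_of_exists_ge hcont ⟨r, hθ.1.le⟩ ⟨r', hθ.2.le⟩
  obtain ⟨m, hm⟩ := hh.exists_onBar_above hT hσ hg hq
  obtain ⟨s₁, hs₁, h₁⟩ := hm r
  obtain ⟨s₂, hs₂, h₂⟩ := hm r'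
  have l₁ : s ≤ s₁ := by
    by_contra! hc
    linarith [(hh.pt_mono (k := k) hT r hc.le).1, hθ.1]
  have l₂ : s₂ ≤ s := by
    by_contra! hc
    linarith [(hh.pt_mono (k := k) hT r' hc.le).1, hθ.2]
  have d₁ := (hh.pt_mono (k := k) hT r l₁).2
  have d₂ := (hh.pt_mono (k := k) hT r' l₂).2
  linarith [(abs_le.1 hs₁).2, (abs_le.1 hs₂).1]

/-- The `k`-th height of a point is determined, up to a constant, by its coordinate along `v k`. -/
theorem IsHeight.abs_sub_inner_le (hh : IsHeight T h) (hT : IsTiling T)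
    (hσ : ∀ t ∈ T, t.IsNotched σ) (k : Fin 4) (x : ℂ) :
    |h x k - h (((inner ℝ x (v k) : ℝ) : ℂ) * v k) k| ≤ 6 := by
  obtain ⟨r, hr⟩ := exists_pt k x
  have e0 : ((inner ℝ x (v k) : ℝ) : ℂ) * v k = pt k 0 (inner ℝ x (v k)) := by simp [pt]
  rw [e0, abs_le]
  have h1 := hh.sub_le_six (k := k) hT hσ r 0 (inner ℝ x (v k))
  have h2 := hh.sub_le_six (k := k) hT hσ 0 r (inner ℝ x (v k))
  rw [← hr] at h1 h2
  exact ⟨by linarith, h2⟩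

end Level

end Octagonal

/-! ### Almost additive functions of a real variable. -/

/-- Hyers' theorem: a Lipschitz function that is additive up to a constant is linear up to the same
constant. -/
theorem exists_linear_of_almost_additive {F : ℝ → ℝ} {M K : ℝ}
    (hM : ∀ a b, |F (a + b) - F a - F b| ≤ M) (hK : ∀ a b, |F a - F b| ≤ K * |a - b|) :
    ∃ α, ∀ x, |F x - α * x| ≤ M := by
  -- The limit of these rescalings is exactly additive, because the defect `M` is divided by `2 ^
  -- n`; it inherits the Lipschitz bound, hence is linear.
  set u : ℝ → ℕ → ℝ := fun x n => F (2 ^ n * x) / 2 ^ n with hu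
  have hdist : ∀ x n, dist (u x n) (u x (n + 1)) ≤ M / 2 / 2 ^ n := by
    intro x n
    have h := hM (2 ^ n * x) (2 ^ n * x)
    have e : u x n - u x (n + 1) =
        -(F (2 ^ n * x + 2 ^ n * x) - F (2 ^ n * x) - F (2 ^ n * x)) / (2 * 2 ^ n) := by
      simp only [hu]
      rw [pow_succ, show (2 : ℝ) ^ n * 2 * x = 2 ^ n * x + 2 ^ n * x by ring]
      field_simp
      ring
    rw [Real.dist_eq, e, abs_div, abs_neg, abs_of_pos (by positivity : (0 : ℝ) < 2 * 2 ^ n),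
      div_div]
    gcongr
  choose g hg using fun x => cauchySeq_tendsto_of_complete (cauchySeq_of_le_geometric_two (hdist x))
  have hFg : ∀ x, |F x - g x| ≤ M := fun x => by
    have := dist_le_of_le_geometric_two_of_tendsto₀ (hdist x) (hg x)
    simpa [hu, Real.dist_eq] using this
  have h2 : Tendsto (fun n : ℕ => M / (2 : ℝ) ^ n) atTop (𝓝 0) :=
    tendsto_const_nhds.div_atTop (tendsto_pow_atTop_atTop_of_one_lt one_lt_two)
  have hadd : ∀ a b, g (a + b) = g a + g b := by
    intro a b
    have h1 : Tendsto (fun n => u (a + b) n - u a n - u b n) atTop (𝓝 0) := by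
      refine squeeze_zero_norm (fun n => ?_) h2
      have e : u (a + b) n - u a n - u b n =
          (F (2 ^ n * a + 2 ^ n * b) - F (2 ^ n * a) - F (2 ^ n * b)) / 2 ^ n := by
        simp only [hu]
        rw [mul_add]
        ring
      rw [Real.norm_eq_abs, e, abs_div, abs_of_pos (by positivity : (0 : ℝ) < 2 ^ n)]
      gcongr
      exact hM _ _
    linarith [tendsto_nhds_unique h1 (((hg (a + b)).sub (hg a)).sub (hg b))]
  have hlip : ∀ a b, |g a - g b| ≤ K * |a - b| := by
    intro a b
    refine le_of_tendsto ((hg a).sub (hg b)).abs (Eventually.of_forall fun n => ?_)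
    have e : u a n - u b n = (F (2 ^ n * a) - F (2 ^ n * b)) / 2 ^ n := by
      simp only [hu]; ring
    rw [e, abs_div, abs_of_pos (by positivity : (0 : ℝ) < 2 ^ n), div_le_iff₀ (by positivity)]
    refine (hK _ _).trans_eq ?_
    rw [← mul_sub, abs_mul, abs_of_pos (by positivity : (0 : ℝ) < 2 ^ n)]
    ring
  have hcont : Continuous g := by
    have hK0 : 0 ≤ K := by simpa using (abs_nonneg _).trans (hK 1 0)
    exact (LipschitzWith.of_dist_le_mul (K := ⟨K, hK0⟩) fun a b => hlip a b).continuous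
  let G : ℝ →L[ℝ] ℝ := (AddMonoidHom.mk' g hadd).toRealLinearMap hcont
  refine ⟨g 1, fun x => ?_⟩
  have hgx : g x = g 1 * x := by
    have : G (x • 1) = x • G 1 := map_smul G x 1
    rw [smul_eq_mul, mul_one, smul_eq_mul, mul_comm] at this
    exact this
  rw [← hgx]
  exact hFg x

/-! ### From almost additivity to a plane at bounded distance from the lift. -/

namespace Octagonal

theorem sum_fin_four_shift {M : Type*} [AddCommMonoid M] (f : Fin 4 → M) (k : Fin 4) :
    ∑ i, f i = f k + f (k + 1) + f (k + 2) + f (k + 3) := by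
  rw [← Equiv.sum_comp (Equiv.addLeft k), Fin.sum_univ_four]
  simp

theorem inner_I_mul (w z : ℂ) : inner ℝ (Complex.I * w) z = cr w z := by
  simp [cr]; ring

theorem cr_sum_left {ι : Type*} (s : Finset ι) (f : ι → ℂ) (w : ℂ) :
    cr (∑ i ∈ s, f i) w = ∑ i ∈ s, cr (f i) w := by
  classical
  induction s using Finset.induction_on with
  | empty => simp [cr]
  | insert a s ha ih => rw [Finset.sum_insert ha, Finset.sum_insert ha, cr_add_left, ih]

theorem inner_real_mul (a : ℝ) (z w : ℂ) : inner ℝ (a * z) w = a * inner ℝ z w := by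
  rw [← Complex.real_smul, real_inner_smul_left]

/-- If functions of the coordinates along the `v k` reconstruct every point of the plane up to a
constant, then they are additive up to a constant. -/
theorem almost_additive {ψ : Fin 4 → ℝ → ℝ} {C : ℝ} (h0 : ∀ k, ψ k 0 = 0)
    (hψ : ∀ x : ℂ, ‖(∑ k, (ψ k (inner ℝ x (v k)) : ℂ) * v k) - x‖ ≤ C) (k : Fin 4) (a b : ℝ) :
    |ψ k (a + b) - ψ k a - ψ k b| ≤ 6 * C := by
  set l := k + 1 with hl
  set m := k + 2 with hm
  set n := k + 3 with hn
  have hkl : k ≠ l := by rw [hl]; revert k; decide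
  have hmk : m ≠ k := by rw [hm]; clear hl hm hn; revert k; decide
  have hnk : n ≠ k := by rw [hn]; clear hl hm hn; revert k; decide
  have hbound : ∀ x : ℂ, |(∑ i, ψ i (inner ℝ x (v i)) * cr (v i) (v l)) - cr x (v l)| ≤ C := by
    intro x
    have h1 := abs_cr_le ((∑ i, (ψ i (inner ℝ x (v i)) : ℂ) * v i) - x) (v l)
    rw [norm_v, mul_one, sub_eq_add_neg, cr_add_left, cr_sum_left, ← sub_eq_add_neg] at h1
    have e1 : cr (-x) (v l) = -cr x (v l) := by simp [cr]; ring
    simp only [cr_smul_left, e1] at h1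
    exact h1.trans (hψ x)
  -- `A` is perpendicular to `v m` and `B` to `v n`, with coordinates `a` and `b` along `v k`. The
  -- cross product with `v l` removes the `l`-term; in the combination for `A + B`, `A`, `B` the
  -- `m`- and `n`-terms cancel, leaving only the defect of `ψ k`. Three errors `C`, divided by a
  -- cross product of size at least `1/2`, give `6 * C`.
  let A : ℂ := (a / cr (v m) (v k) : ℝ) * (Complex.I * v m)
  let B : ℂ := (b / cr (v n) (v k) : ℝ) * (Complex.I * v n)
  have hAk : inner ℝ A (v k) = a := by
    rw [inner_real_mul, inner_I_mul, div_mul_cancel₀ _ (cr_ne_zero hmk)]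
  have hBk : inner ℝ B (v k) = b := by
    rw [inner_real_mul, inner_I_mul, div_mul_cancel₀ _ (cr_ne_zero hnk)]
  have hAm : inner ℝ A (v m) = 0 := by rw [inner_real_mul, inner_I_mul, cr_self, mul_zero]
  have hBn : inner ℝ B (v n) = 0 := by rw [inner_real_mul, inner_I_mul, cr_self, mul_zero]
  have hA := abs_le.1 (hbound A)
  have hB := abs_le.1 (hbound B)
  have hAB := abs_le.1 (hbound (A + B))
  rw [sum_fin_four_shift _ k, ← hl, ← hm, ← hn] at hA hB hAB
  simp only [inner_add_left, hAk, hBk, hAm, hBn, h0, cr_self, cr_add_left, zero_add, add_zero,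
    mul_zero, zero_mul] at hA hB hAB
  have hc : 1 / 2 ≤ |cr (v k) (v l)| := by
    rcases lt_or_gt_of_ne hkl with h | h
    · exact (half_le_cr h).trans (le_abs_self _)
    · rw [cr_swap, abs_neg]; exact (half_le_cr h).trans (le_abs_self _)
  have key : |(ψ k (a + b) - ψ k a - ψ k b) * cr (v k) (v l)| ≤ 3 * C :=
    abs_le.2 ⟨by linarith [hA.2, hB.2, hAB.1], by linarith [hA.1, hB.1, hAB.2]⟩
  rw [abs_mul] at key
  nlinarith [abs_nonneg (ψ k (a + b) - ψ k a - ψ k b)]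

section

variable {T : Set Tile} {h : ℂ → Fin 4 → ℝ} {σ : ℂ → Fin 4 → Bool}

/-- The constants: four errors `6` give `24` in the reconstruction, whence a defect `6 * 24 = 144`;
replacing `x` by its projection on the axis `v k` costs another `6`. -/
theorem IsHeight.exists_linear (hh : IsHeight T h) (hT : IsTiling T)
    (hσ : ∀ t ∈ T, t.IsNotched σ) :
    ∃ α : Fin 4 → ℝ, ∀ x k, |h x k - h 0 k - α k * inner ℝ x (v k)| ≤ 150 := by
  let ψ : Fin 4 → ℝ → ℝ := fun k s => h (s * v k) k - h 0 k
  have hψ : ∀ x : ℂ, ‖(∑ k, (ψ k (inner ℝ x (v k)) : ℂ) * v k) - x‖ ≤ 24 := by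
    intro x
    have e1 : (∑ k, (ψ k (inner ℝ x (v k)) : ℂ) * v k) - x =
        ∑ k, ((h ((inner ℝ x (v k) : ℝ) * v k) k - h x k : ℝ) : ℂ) * v k := by
      trans (∑ k, (ψ k (inner ℝ x (v k)) : ℂ) * v k) - ∑ k, ((h x k - h 0 k : ℝ) : ℂ) * v k
      · rw [hh.sum_eq hT x]
      rw [← Finset.sum_sub_distrib]
      refine Finset.sum_congr rfl fun k _ => ?_
      simp only [ψ]
      push_cast
      ring
    rw [e1]
    refine (norm_sum_le_of_le (f := fun k : Fin 4 => _) (n := fun _ => 6) Finset.univ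
      fun k _ => ?_).trans_eq (by norm_num)
    rw [norm_mul, norm_v, mul_one, Complex.norm_real, Real.norm_eq_abs, abs_sub_comm]
    exact hh.abs_sub_inner_le hT hσ k x
  have h0 : ∀ k, ψ k 0 = 0 := fun k => by simp [ψ]
  have hlin : ∀ k, ∃ α, ∀ s, |ψ k s - α * s| ≤ 6 * 24 := fun k =>
    exists_linear_of_almost_additive (K := 2) (almost_additive h0 hψ k) fun a b => by
      have := hh.abs_sub_le hT k (b * v k) (a * v k)
      rw [← sub_mul, norm_mul, norm_v, mul_one, ← Complex.ofReal_sub, Complex.norm_real,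
        Real.norm_eq_abs] at this
      simpa [ψ] using this
  choose α hα using hlin
  refine ⟨α, fun x k => ?_⟩
  have h1 := abs_le.1 (hα k (inner ℝ x (v k)))
  have h2 := abs_le.1 (hh.abs_sub_inner_le hT hσ k x)
  simp only [ψ] at h1
  exact abs_le.2 ⟨by linarith [h1.1, h2.1], by linarith [h1.2, h2.2]⟩

/-- The linear map `x ↦ (α k ⟪x, v k⟫)`. -/
noncomputable def slope (α : Fin 4 → ℝ) : ℂ →ₗ[ℝ] (Fin 4 → ℝ) where
  toFun x k := α k * inner ℝ x (v k)
  map_add' x y := by ext k; simp [inner_add_left, mul_add]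
  map_smul' c x := by ext k; simp; ring

/-- On a line in the kernel the heights would stay bounded, although they reconstruct the point.
Injectivity makes the range two-dimensional. -/
theorem IsHeight.slope_injective (hh : IsHeight T h) (hT : IsTiling T) {α : Fin 4 → ℝ} {C : ℝ}
    (hα : ∀ x k, |h x k - h 0 k - α k * inner ℝ x (v k)| ≤ C) :
    Function.Injective (slope α) := by
  rw [injective_iff_map_eq_zero]
  intro x hx
  by_contra hx0
  have hn : ∀ n : ℕ, (n : ℝ) * ‖x‖ ≤ 4 * C := by
    intro n
    have h1 : ∀ k, |h (n • x) k - h 0 k| ≤ C := fun k => by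
      have h2 := hα (n • x) k
      have h3 : slope α (n • x) k = 0 := by rw [map_nsmul, hx]; simp
      rw [show α k * inner ℝ (n • x) (v k) = 0 from h3, sub_zero] at h2
      exact h2
    calc (n : ℝ) * ‖x‖ = ‖n • x‖ := by rw [nsmul_eq_mul, norm_mul, Complex.norm_natCast]
      _ = ‖∑ k, ((h (n • x) k - h 0 k : ℝ) : ℂ) * v k‖ := by rw [hh.sum_eq hT]
      _ ≤ ∑ _k : Fin 4, C := norm_sum_le_of_le _ fun k _ => by
          rw [norm_mul, norm_v, mul_one, Complex.norm_real]; exact h1 k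
      _ = 4 * C := by simp
  obtain ⟨n, hn'⟩ := exists_nat_gt (4 * C / ‖x‖)
  rw [div_lt_iff₀ (norm_pos_iff.2 hx0)] at hn'
  linarith [hn n]

theorem Tile.edgeStart_mem (t : Tile) {d : Fin 4 → ℤ} {k : Fin 4} (hd : (d, k) ∈ t.edges) :
    t.edgeStart d ∈ t.carrier ∧ t.lin (proj d) = fun l => (d l : ℝ) := by
  have hcast : ∀ l : Fin 4, (Pi.single l 1 : Fin 4 → ℝ) = fun q => ((e l q : ℤ) : ℝ) := fun l => by
    ext q; simp [e, Pi.single_apply]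
  have hmem : ∀ l, l = t.i ∨ l = t.j → t.edgeStart (e l) ∈ t.carrier := by
    intro l hl
    rw [edgeStart, proj_e, mem_carrier_iff, add_sub_cancel_left, t.lin_v_self hl]
    simp only [Pi.single_apply]
    constructor <;> split_ifs <;> simp
  have h0 : t.edgeStart 0 ∈ t.carrier ∧ t.lin (proj 0) = fun l => (((0 : Fin 4 → ℤ) l : ℤ) : ℝ) := by
    rw [edgeStart, proj_zero, add_zero, map_zero]
    exact ⟨t.base_mem, by ext; simp⟩
  rcases hd with h | h | h | h <;> obtain ⟨rfl, -⟩ := Prod.mk.inj h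
  · exact h0
  · exact ⟨hmem _ (.inr rfl), by rw [proj_e, lin_v_j, hcast]⟩
  · exact h0
  · exact ⟨hmem _ (.inl rfl), by rw [proj_e, lin_v_i, hcast]⟩

/-- The height need not be integral at vertices, but along the edges of a tile it changes by
integers, with which the floor commutes. -/
theorem IsHeight.isLift_floor (hh : IsHeight T h) : IsLift T fun t l => ⌊h t.base l⌋ := by
  intro s hs t ht k d d' hd hd' heq
  have key : ∀ t ∈ T, ∀ d, (d, k) ∈ t.edges → ∀ l, h (t.edgeStart d) l = h t.base l + d l := by
    intro t ht d hd l
    have h1 := t.edgeStart_mem hd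
    rw [hh t ht _ t.base_mem _ h1.1, Tile.edgeStart, add_sub_cancel_left, h1.2]
    rfl
  ext l
  rw [Pi.add_apply, Pi.add_apply, ← Int.floor_add_intCast, ← Int.floor_add_intCast,
    ← key s hs d hd l, ← key t ht d' hd' l, heq]

end

end Octagonal

theorem lemma1 :
    ∃ τ : ℝ, 1 ≤ τ ∧
      ∀ T : Set Octagonal.Tile, Octagonal.IsNotchedTiling T → Octagonal.IsPlanar T τ := by
  -- A point of a face differs from the linear approximation at the base by at most `150`, plus an
  -- error in `[-1, 2]` from the floor and the position in the face. Lowering the plane by `160`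
  -- puts this in `[9, 312]`, well inside `[0, 400]`.
  refine ⟨400, by norm_num, fun T ⟨hT, σ, hσ⟩ => ?_⟩
  obtain ⟨h, hh⟩ := hT.exists_height
  obtain ⟨α, hα⟩ := hh.exists_linear hT hσ
  refine ⟨AffineSubspace.mk' (fun k => h 0 k - 160) (LinearMap.range (Octagonal.slope α)), ?_,
    fun t l => ⌊h t.base l⌋, hh.isLift_floor, ?_⟩
  · rw [AffineSubspace.direction_mk', LinearMap.finrank_range_of_inj (hh.slope_injective hT hα),
      Complex.finrank_real_complex]
  · refine Set.iUnion₂_subset fun t _ => ?_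
    rintro _ ⟨a, ha, b, hb, rfl⟩
    refine Set.mem_add.2 ⟨fun k => h 0 k - 160 + α k * inner ℝ t.base (Octagonal.v k), ?_, _, ?_,
      add_sub_cancel _ _⟩
    · refine AffineSubspace.mem_mk'.2 ⟨t.base, ?_⟩
      ext k
      simp [Octagonal.slope]
    · have h01 : ∀ c ∈ Set.Icc (0 : ℝ) 1, ∀ i k : Fin 4,
          0 ≤ c * (Pi.single i 1 : Fin 4 → ℝ) k ∧ c * (Pi.single i 1 : Fin 4 → ℝ) k ≤ 1 := by
        intro c hc i k
        rw [Pi.single_apply]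
        split_ifs
        · rw [mul_one]; exact hc
        · rw [mul_zero]; exact ⟨le_rfl, zero_le_one⟩
      have hk := fun k => abs_le.1 (hα t.base k)
      have hf := fun k => Int.floor_le (h t.base k)
      have hf' := fun k => Int.lt_floor_add_one (h t.base k)
      constructor <;> intro k <;>
        simp only [Pi.sub_apply, Pi.add_apply, Pi.smul_apply, smul_eq_mul, Pi.zero_apply] <;>
        linarith [hk k, hf k, hf' k, (h01 a ha t.i k).1, (h01 a ha t.i k).2, (h01 b hb t.j k).1,
          (h01 b hb t.j k).2, (hk k).1, (hk k).2]
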